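/- Let $d\in\mathbb N$. For a vector $|x\rangle\in\mathbb C^d\otimes\mathbb C^d$ let $X\in\mathcal M_d(\mathbb C)$ be the matrix with $|x\rangle=(X\otimes I)\sum_{i=1}^d|i\rangle|i\rangle$, and put $G(|x\rangle)=|\det X|^{2/d}$. The map $|x\rangle\mapsto X$ is a linear isomorphism $\mathbb C^d\otimes\mathbb C^d\cong\mathcal M_d(\mathbb C)$, by which subspaces of the two spaces are identified. For a density matrix $\rho^{AB}$ on $\mathbb C^d\otimes\mathbb C^d$, define the G-concurrence and the G-concurrence of assistance $$G(\rho^{AB})=\min\sum_{j=1}^n p_j\,G(|\psi_j\rangle),\qquad G_a(\rho^{AB})=\max\sum_{j=1}^n p_j\,G(|\psi_j\rangle),$$ where the minimum and the maximum run over all finite decompositions $\rho^{AB}=\sum_{j=1}^n p_j|\psi_j\rangle\langle\psi_j|$ into pure states ($p_j\ge 0$, $\sum_j p_j=1$, $\langle\psi_j|\psi_j\rangle=1$; $n$ is arbitrary). **Theorem.** Let $\rho^{AB}$ be a density matrix on $\mathbb C^d\otimes\mathbb C^d$ of rank $r$. Then $G(\rho^{AB})=G_a(\rho^{AB})>0$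 if and only if $r\le 1+\frac{d(d-1)}2$ and there are an invertible matrix $X\in\mathcal M_d(\mathbb C)$ and a linear subspace $\mathcal N_0\subseteq\mathcal M_d(\mathbb C)$ of dimension $r-1$, consisting of nilpotent matrices, such that $$\mathrm{supp}(\rho^{AB})=\{X(cI+N)\;:\;c\in\mathbb C,\ N\in\mathcal N_0\},$$ where the support (range) of $\rho^{AB}$ is viewed as a subspace of $\mathcal M_d(\mathbb C)$. -/

import Mathlib

open scoped Kronecker Matrix ComplexOrder

noncomputable section

namespace GConc

/-- Vectors of `ℂ^d ⊗ ℂ^d`, written in the product basis `|i⟩ ⊗ |j⟩`. -/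
abbrev Vec (d : ℕ) : Type := Fin d × Fin d → ℂ

/-- Operators on `ℂ^d ⊗ ℂ^d`, written as matrices in the product basis. -/
abbrev Op (d : ℕ) : Type := Matrix (Fin d × Fin d) (Fin d × Fin d) ℂ

/-- The unnormalized maximally entangled vector `|φ₊⟩ = ∑ i, |i⟩ ⊗ |i⟩`. -/
def phiPlus (d : ℕ) : Vec d := ∑ i : Fin d, Pi.single (i, i) 1

/-- The linear isomorphism `|x⟩ ↦ X` from `ℂ^d ⊗ ℂ^d` to the `d × d` matrices. It is the inverse of
`X ↦ (X ⊗ I)|φ₊⟩`, see `kronecker_one_mulVec_phiPlus`. -/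
def toMat (d : ℕ) : Vec d ≃ₗ[ℂ] Matrix (Fin d) (Fin d) ℂ where
  toFun x := Matrix.of fun i j => x (i, j)
  invFun X := fun p => X p.1 p.2
  map_add' _ _ := rfl
  map_smul' _ _ := rfl
  left_inv _ := rfl
  right_inv _ := rfl

theorem kronecker_one_mulVec_phiPlus {d : ℕ} (X : Matrix (Fin d) (Fin d) ℂ) :
    (X ⊗ₖ (1 : Matrix (Fin d) (Fin d) ℂ)) *ᵥ phiPlus d = (toMat d).symm X := by
  ext ⟨i, j⟩
  simp [phiPlus, Matrix.mulVec_sum, Matrix.one_apply]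
  rfl

/-- The G-concurrence `|det X|^(2/d)` of a vector `|x⟩ = (X ⊗ I)|φ₊⟩` of `ℂ^d ⊗ ℂ^d`. -/
def pureG {d : ℕ} (x : Vec d) : ℝ := ‖(toMat d x).det‖ ^ ((2 : ℝ) / d)

/-- The rank-one operator `|x⟩⟨x|`. -/
def proj {d : ℕ} (x : Vec d) : Op d := Matrix.vecMulVec x (star x)

/-- `x` is normalized, `⟨x|x⟩ = 1`. -/
def IsUnitVec {d : ℕ} (x : Vec d) : Prop := star x ⬝ᵥ x = 1

/-- Density matrices on `ℂ^d ⊗ ℂ^d`. -/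
structure IsDensityMatrix {d : ℕ} (ρ : Op d) : Prop where
  posSemidef : ρ.PosSemidef
  trace_eq_one : ρ.trace = 1

/-- A finite pure state decomposition `ρ = ∑ j, p j |ψ j⟩⟨ψ j|`. -/
structure IsPureDecomposition {d : ℕ} (ρ : Op d) (n : ℕ) (p : Fin n → ℝ) (ψ : Fin n → Vec d) :
    Prop where
  nonneg : ∀ j, 0 ≤ p j
  sum_eq_one : ∑ j, p j = 1
  unit : ∀ j, IsUnitVec (ψ j)
  eq_sum : ρ = ∑ j, p j • proj (ψ j)

/-- The average G-concurrences `∑ j, p j G(ψ j)` of all pure state decompositions of `ρ`. -/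
def averages {d : ℕ} (ρ : Op d) : Set ℝ :=
  {t | ∃ (n : ℕ) (p : Fin n → ℝ) (ψ : Fin n → Vec d),
    IsPureDecomposition ρ n p ψ ∧ t = ∑ j, p j * pureG (ψ j)}

/-- The G-concurrence of a mixed state: the minimal average over the pure state decompositions
(the minimum is attained, see `isLeast_G`). -/
def G {d : ℕ} (ρ : Op d) : ℝ := sInf (averages ρ)

/-- The G-concurrence of assistance: the maximal average over the pure state decompositions
(the maximum is attained, see `isGreatest_Ga`). -/
def Ga {d : ℕ} (ρ : Op d) : ℝ := sSup (averages ρ)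

/-- The support of a Hermitian operator: its range in `ℂ^d ⊗ ℂ^d`. -/
def supp {d : ℕ} (ρ : Op d) : Submodule ℂ (Vec d) := LinearMap.range ρ.mulVecLin

/-- The support of `ρ`, viewed as a subspace of the `d × d` matrices. -/
def matSupp {d : ℕ} (ρ : Op d) : Submodule ℂ (Matrix (Fin d) (Fin d) ℂ) :=
  (supp ρ).map (toMat d).toLinearMap

theorem isUnitVec_iff {d : ℕ} (x : Vec d) : IsUnitVec x ↔ ‖WithLp.toLp 2 x‖ = 1 := by
  have h : star x ⬝ᵥ x = ((‖WithLp.toLp 2 x‖ ^ 2 : ℝ) : ℂ) := by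
    rw [EuclideanSpace.norm_sq_eq]
    simp [dotProduct, Complex.conj_mul']
  rw [IsUnitVec, h]
  norm_cast
  exact pow_eq_one_iff_of_nonneg (norm_nonneg _) two_ne_zero

theorem isCompact_isUnitVec (d : ℕ) : IsCompact {x : Vec d | IsUnitVec x} := by
  have h : {x : Vec d | IsUnitVec x} =
      (EuclideanSpace.equiv (Fin d × Fin d) ℂ).symm ⁻¹' Metric.sphere 0 1 := by
    ext x
    simp [isUnitVec_iff]
  rw [h]
  exact (EuclideanSpace.equiv (Fin d × Fin d) ℂ).symm.toHomeomorph.isCompact_preimage.2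
    (isCompact_sphere _ _)

theorem averages_eq {d : ℕ} (ρ : Op d) : averages ρ =
    {t | (ρ, t) ∈ convexHull ℝ ((fun x : Vec d => (proj x, pureG x)) '' {x | IsUnitVec x})} := by
  ext t
  constructor
  · rintro ⟨n, p, ψ, h, rfl⟩
    have := (convex_convexHull ℝ
      ((fun x : Vec d => (proj x, pureG x)) '' {x | IsUnitVec x})).sum_mem (t := Finset.univ)
      (w := p) (z := fun j => (proj (ψ j), pureG (ψ j))) (fun j _ => h.nonneg j) h.sum_eq_one
      (fun j _ => subset_convexHull _ _ ⟨ψ j, h.unit j, rfl⟩)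
    have e : ∑ j, p j • ((proj (ψ j), pureG (ψ j)) : Op d × ℝ)
        = (ρ, ∑ j, p j * pureG (ψ j)) := by
      ext1
      · simp [Prod.fst_sum, h.eq_sum]
      · simp [Prod.snd_sum]
    rwa [e] at this
  · intro h
    obtain ⟨ι, _, w, z, hw, hw1, hz, e⟩ := mem_convexHull_iff_exists_fintype.1 h
    choose x hx hxz using hz
    let f := (Fintype.equivFin ι).symm
    refine ⟨Fintype.card ι, w ∘ f, x ∘ f, ⟨fun j => hw _, ?_, fun j => hx _, ?_⟩, ?_⟩
    · rw [← hw1]; exact f.sum_comp w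
    · have := congrArg Prod.fst e
      simp only [← hxz, Prod.fst_sum, Prod.smul_mk] at this
      rw [← this]
      exact (f.sum_comp (fun i => w i • proj (x i))).symm
    · have := congrArg Prod.snd e
      simp only [← hxz, Prod.snd_sum, Prod.smul_mk] at this
      rw [← this]
      exact (f.sum_comp (fun i => w i * pureG (x i))).symm

theorem isCompact_convexHull_of_finiteDimensional {E : Type*} [AddCommGroup E] [Module ℝ E]
    [TopologicalSpace E] [ContinuousAdd E] [ContinuousSMul ℝ E] [FiniteDimensional ℝ E]
    {s : Set E} (hs : IsCompact s) : IsCompact (convexHull ℝ s) := by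
  let S : ℕ → Set E := fun m => (fun q : (Fin m → ℝ) × (Fin m → E) => ∑ i, q.1 i • q.2 i) ''
    (stdSimplex ℝ (Fin m) ×ˢ Set.univ.pi fun _ => s)
  have hS : ∀ m, IsCompact (S m) := fun m =>
    ((isCompact_stdSimplex ℝ (Fin m)).prod (isCompact_univ_pi fun _ => hs)).image (by fun_prop)
  have : convexHull ℝ s = ⋃ m ∈ Set.Iic (Module.finrank ℝ E + 1), S m := by
    ext x
    simp only [Set.mem_iUnion, Set.mem_Iic, exists_prop]
    constructor
    · intro hx
      obtain ⟨ι, _, z, w, hz, ha, hw, hw1, e⟩ := eq_pos_convex_span_of_mem_convexHull hx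
      let f := (Fintype.equivFin ι).symm
      refine ⟨Fintype.card ι, ?_, (w ∘ f, z ∘ f), ⟨⟨fun j => (hw _).le, ?_⟩, ?_⟩, ?_⟩
      · exact ha.card_le_finrank_succ.trans (Nat.succ_le_succ (Submodule.finrank_le _))
      · rw [← hw1]; exact f.sum_comp w
      · exact fun j _ => hz ⟨f j, rfl⟩
      · rw [← e]; exact f.sum_comp fun i => w i • z i
    · rintro ⟨m, -, q, ⟨hq, hq2⟩, rfl⟩
      exact (convex_convexHull ℝ s).sum_mem (fun i _ => hq.1 i) hq.2
        fun i _ => subset_convexHull _ _ (hq2 i trivial)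
  rw [this]
  exact (Set.finite_Iic _).isCompact_biUnion fun m _ => hS m

theorem isCompact_averages {d : ℕ} (ρ : Op d) : IsCompact (averages ρ) := by
  have hc : Continuous (fun x : Vec d => (proj x, pureG x)) := by
    refine Continuous.prodMk ?_ ?_
    · exact continuous_id.matrix_vecMulVec continuous_star
    · refine Continuous.rpow_const ?_ fun x => Or.inr (by positivity)
      refine (Continuous.matrix_det ?_).norm
      exact continuous_matrix fun i j => continuous_apply (i, j)
  have hK := isCompact_convexHull_of_finiteDimensional ((isCompact_isUnitVec d).image hc)
  have : averages ρ = Prod.snd '' (convexHull ℝ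
      ((fun x : Vec d => (proj x, pureG x)) '' {x | IsUnitVec x}) ∩ Prod.fst ⁻¹' {ρ}) := by
    rw [averages_eq]
    ext t
    constructor
    · intro h
      exact ⟨(ρ, t), ⟨h, rfl⟩, rfl⟩
    · rintro ⟨⟨a, b⟩, ⟨h, h1⟩, rfl⟩
      obtain rfl : a = ρ := h1
      exact h
  rw [this]
  exact (hK.inter_right (isClosed_singleton.preimage continuous_fst)).image continuous_snd

theorem averages_nonempty {d : ℕ} {ρ : Op d} (hρ : IsDensityMatrix ρ) : (averages ρ).Nonempty := by
  have hH := hρ.posSemidef.isHermitian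
  let f := (Fintype.equivFin (Fin d × Fin d)).symm
  let v : Fin d × Fin d → Vec d := fun k => (hH.eigenvectorBasis k).ofLp
  refine ⟨_, Fintype.card (Fin d × Fin d), hH.eigenvalues ∘ f, v ∘ f,
    ⟨fun j => hρ.posSemidef.eigenvalues_nonneg _, ?_, fun j => ?_, ?_⟩, rfl⟩
  · have h := hH.trace_eq_sum_eigenvalues
    rw [hρ.trace_eq_one] at h
    have h2 : ∑ i, hH.eigenvalues i = 1 := by
      have := congrArg Complex.re h
      simpa using this.symm
    rw [← h2]; exact f.sum_comp hH.eigenvalues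
  · rw [isUnitVec_iff]
    exact hH.eigenvectorBasis.orthonormal.1 _
  · have h : ρ = ∑ k, hH.eigenvalues k • proj (v k) := by
      ext a b
      conv_lhs => rw [hH.spectral_theorem, Unitary.conjStarAlgAut_apply]
      rw [Matrix.mul_apply, Matrix.sum_apply]
      refine Finset.sum_congr rfl fun k _ => ?_
      simp [Matrix.mul_diagonal, proj, v, Matrix.vecMulVec_apply]
      ring
    refine h.trans ?_
    exact (f.sum_comp (fun k => hH.eigenvalues k • proj (v k))).symm

theorem isLeast_G {d : ℕ} {ρ : Op d} (hρ : IsDensityMatrix ρ) : IsLeast (averages ρ) (G ρ) :=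
  (isCompact_averages ρ).isLeast_sInf (averages_nonempty hρ)

theorem isGreatest_Ga {d : ℕ} {ρ : Op d} (hρ : IsDensityMatrix ρ) :
    IsGreatest (averages ρ) (Ga ρ) :=
  (isCompact_averages ρ).isGreatest_sSup (averages_nonempty hρ)

end GConc

end

/-! `G ρ = Ga ρ` says that every pure-state decomposition of `ρ` has the same average.

If so, let a, b in the support be singular. Trading small multiples of the projections on a and b
for those on a + b and a - b gives another decomposition, so a + b is singular too
(`pureG_add_eq_zero`). Hence the singular matrices of the support S form a subspace Z. Positivity
yields an invertible X in S. Subtracting from M an eigenvalue of X⁻¹M times X makes it singular, so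
S = ℂX ⊕ Z. For N in Z, a nonzero eigenvalue c of X⁻¹N would put cX in Z, so X⁻¹N is nilpotent
(`exists_nilpotent_of_det_add`). Gerstenhaber's theorem then bounds the rank.

Conversely, det (X(cI + N)) = c^d det X, so on S the G-concurrence is a constant times |c|², and c =
tr(X⁻¹M)/d is linear in M. The sum of |c|² over a decomposition is a quadratic expression in `ρ`
alone (`sum_norm_sq_eq`). -/

namespace GConc

/-! ### Gerstenhaber's theorem, by induction on the dimension. -/

/-- The maps induced on a quotient by a linear family of endomorphisms that preserve a subspace. -/
def quotientMap {K A V : Type*} [Field K] [AddCommMonoid A] [Module K A] [AddCommGroup V]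
    [Module K V] (L : Submodule K V) (i : A →ₗ[K] Module.End K V) (h : ∀ a, L ≤ L.comap (i a)) :
    A →ₗ[K] Module.End K (V ⧸ L) where
  toFun a := L.mapQ L (i a) (h a)
  map_add' _ _ := by
    refine Submodule.linearMap_qext _ (LinearMap.ext fun v => ?_)
    simp
  map_smul' _ _ := by
    refine Submodule.linearMap_qext _ (LinearMap.ext fun v => ?_)
    simp

open Module in
/-- A linear family of nilpotent endomorphisms that kill `x` is controlled by the family induced
on the quotient by `x` and by the functionals `φ` for which `v ↦ φ v • x` is in the family. -/
theorem finrank_le_add_of_apply_eq_zero {K A V : Type*} [Field K] [AddCommGroup A] [Module K A]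
    [FiniteDimensional K A] [AddCommGroup V] [Module K V] [FiniteDimensional K V] {x : V}
    (i : A →ₗ[K] End K V) (hi : Function.Injective i) (hA : ∀ a, IsNilpotent (i a))
    (hx : ∀ a, i a x = 0) {b : ℕ}
    (hb : ∀ Q : Submodule K (End K (V ⧸ K ∙ x)), (∀ w ∈ Q, IsNilpotent w) → finrank K Q ≤ b)
    (D : Submodule K (Dual K V))
    (hD : ∀ a, ∀ φ : Dual K V, (i a = φ.smulRight x) → φ ∈ D) (hx0 : x ≠ 0) :
    finrank K A ≤ b + finrank K D := by
  -- `f` reads off the coefficient of a multiple of `x`.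
  obtain ⟨f, hf⟩ : ∃ f : Dual K V, f x = 1 := by
    obtain ⟨f, hf⟩ := Projective.exists_dual_ne_zero K hx0
    exact ⟨(f x)⁻¹ • f, by simp [inv_mul_cancel₀ hf]⟩
  have hle : ∀ a, (K ∙ x) ≤ (K ∙ x).comap (i a) := by
    intro a
    rw [Submodule.span_singleton_le_iff_mem, Submodule.mem_comap, hx a]
    exact Submodule.zero_mem _
  let q := quotientMap (K ∙ x) i hle
  have hq : ∀ a v, q a ((K ∙ x).mkQ v) = (K ∙ x).mkQ (i a v) := fun _ _ => rfl
  have h2 := q.finrank_range_add_finrank_ker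
  have h3 : finrank K (LinearMap.range q) ≤ b := by
    refine hb _ ?_
    rintro _ ⟨w, rfl⟩
    obtain ⟨k, hk⟩ := hA w
    refine ⟨k, ?_⟩
    have : ∀ (m : ℕ) v, (q w ^ m) ((K ∙ x).mkQ v) = (K ∙ x).mkQ ((i w ^ m) v) := by
      intro m
      induction m with
      | zero => simp
      | succ m ihm => intro v; rw [pow_succ, pow_succ, Module.End.mul_apply, hq, ihm]; rfl
    refine LinearMap.ext fun v => ?_
    obtain ⟨v, rfl⟩ := (K ∙ x).mkQ_surjective v
    rw [this, hk]
    simp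
  -- Acting as zero on the quotient means having image in the line of `x`.
  have hker : ∀ (w : LinearMap.ker q), i w = (f ∘ₗ i w).smulRight x := by
    intro w
    refine LinearMap.ext fun v => ?_
    have h : i w v ∈ K ∙ x := by
      rw [← Submodule.Quotient.mk_eq_zero, ← Submodule.mkQ_apply, ← hq, LinearMap.mem_ker.1 w.2]
      rfl
    obtain ⟨c, hc⟩ := Submodule.mem_span_singleton.1 h
    simp [← hc, hf]
  let φ : LinearMap.ker q →ₗ[K] Dual K V :=
    (LinearMap.llcomp K V V K f) ∘ₗ i ∘ₗ (LinearMap.ker q).subtype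
  have hφ : ∀ w, φ w = f ∘ₗ i w := fun _ => rfl
  have hinj : Function.Injective φ := by
    intro w w' h
    refine Subtype.ext (hi ?_)
    rw [hker w, hker w', ← hφ, ← hφ, h]
  have hrange : LinearMap.range φ ≤ D := by
    rintro _ ⟨w, rfl⟩
    exact hD w _ (hker w)
  have h4 : finrank K (LinearMap.ker q) ≤ finrank K D :=
    (LinearMap.finrank_range_of_inj hinj).symm.le.trans (Submodule.finrank_mono hrange)
  omega

-- Polarization: squares of nilpotents have trace zero, and `W` is closed under sums.
open Module in
theorem trace_mul_eq_zero_of_isNilpotent {K V : Type*} [Field K] [CharZero K] [AddCommGroup V]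
    [Module K V] [FiniteDimensional K V] {W : Submodule K (End K V)}
    (hW : ∀ w ∈ W, IsNilpotent w) {u w : End K V} (hu : u ∈ W) (hw : w ∈ W) :
    LinearMap.trace K V (u * w) = 0 := by
  have hsq : ∀ u ∈ W, LinearMap.trace K V (u * u) = 0 := fun u hu =>
    (LinearMap.isNilpotent_trace_of_isNilpotent
      ((Commute.refl u).isNilpotent_mul_right (hW u hu))).eq_zero
  have h := hsq _ (W.add_mem hu hw)
  rw [add_mul, mul_add, mul_add, map_add, map_add, map_add, hsq u hu, hsq w hw,
    LinearMap.trace_mul_comm K w u, zero_add, add_zero, ← two_mul] at h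
  exact (mul_eq_zero.1 h).resolve_left two_ne_zero

open Module in
/-- Gerstenhaber's theorem: a linear space of nilpotent endomorphisms of an `n`-dimensional space
has dimension at most `n.choose 2`. -/
theorem finrank_le_choose_two_of_isNilpotent {K : Type*} [Field K] [CharZero K] (n : ℕ) :
    ∀ {V : Type*} [AddCommGroup V] [Module K V] [FiniteDimensional K V] (_ : finrank K V = n)
      (W : Submodule K (End K V)) (_ : ∀ w ∈ W, IsNilpotent w), finrank K W ≤ n.choose 2 := by
  induction n with
  | zero =>
    intro V _ _ _ hV W _
    have : Subsingleton V := finrank_zero_iff.1 hV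
    have : Subsingleton (End K V) := inferInstance
    simp [finrank_zero_of_subsingleton]
  | succ n ih =>
    intro V _ _ _ hV W hW
    have : Nontrivial V := nontrivial_of_finrank_pos (R := K) (by omega)
    obtain ⟨x, hx⟩ := exists_ne (0 : V)
    let L : Submodule K V := K ∙ x
    have hL : finrank K L = 1 := finrank_span_singleton hx
    let ev : W →ₗ[K] V := (LinearMap.applyₗ x).domRestrict W
    -- A member `φ.smulRight x` of `W` has `φ x = 0` because it kills `x`, and `φ (u x) = 0` for `u
    -- ∈ W` because that is the trace of its product with `u`.
    let D : Submodule K (Dual K V) := (LinearMap.range ev ⊔ L).dualAnnihilator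
    have h1 := ev.finrank_range_add_finrank_ker
    let i : LinearMap.ker ev →ₗ[K] End K V := W.subtype ∘ₗ (LinearMap.ker ev).subtype
    have hix : ∀ a, i a x = 0 := fun a => a.2
    have h2 : finrank K (LinearMap.ker ev) ≤ n.choose 2 + finrank K D := by
      refine finrank_le_add_of_apply_eq_zero (A := LinearMap.ker ev) (x := x)
        i (Subtype.val_injective.comp Subtype.val_injective)
        (fun a => hW _ a.1.2) hix (fun Q hQ => ih ?_ Q hQ) D ?_ hx
      · change finrank K (V ⧸ L) = n
        have := L.finrank_quotient_add_finrank
        omega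
      · intro a φ ha
        rw [Submodule.mem_dualAnnihilator]
        intro v hv
        obtain ⟨_, ⟨u, rfl⟩, y, hy, rfl⟩ := Submodule.mem_sup.1 hv
        obtain ⟨c, rfl⟩ := Submodule.mem_span_singleton.1 hy
        have hax : φ x • x = 0 := by
          rw [← LinearMap.smulRight_apply, ← ha]
          exact a.2
        have h := trace_mul_eq_zero_of_isNilpotent hW a.1.2 u.2
        have e : (a.1 : End K V) * (u : End K V) = (φ ∘ₗ (u : End K V)).smulRight x := by
          refine LinearMap.ext fun v => ?_
          exact LinearMap.congr_fun ha _
        rw [e, LinearMap.trace_smulRight] at h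
        rw [map_add, map_smul, (smul_eq_zero.1 hax).resolve_right hx, smul_zero, add_zero]
        exact h
    have h5 : finrank K (LinearMap.range ev ⊔ L : Submodule K V) + finrank K D = n + 1 := by
      rw [← hV]
      exact Subspace.finrank_add_finrank_dualAnnihilator_eq _
    have h6 : finrank K (LinearMap.range ev ⊔ L : Submodule K V) =
        finrank K (LinearMap.range ev) + 1 := by
      have h := Submodule.finrank_sup_add_finrank_inf_eq (LinearMap.range ev) L
      -- If `u x = c • x` with `u` nilpotent, then `c = 0`.
      have hb : LinearMap.range ev ⊓ L = ⊥ := by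
        rw [eq_bot_iff]
        rintro _ ⟨⟨u, rfl⟩, hy⟩
        obtain ⟨c, hc⟩ := Submodule.mem_span_singleton.1 hy
        have hu : (u : End K V) x = c • x := hc.symm
        obtain ⟨k, hk⟩ := hW u u.2
        have : ∀ m : ℕ, ((u : End K V) ^ m) x = c ^ m • x := by
          intro m
          induction m with
          | zero => simp
          | succ m ihm => rw [pow_succ, Module.End.mul_apply, hu, map_smul, ihm, smul_smul, pow_succ']
        have h0 := this k
        rw [hk] at h0
        have hc0 : c = 0 := by
          have : c ^ k = 0 := by
            rcases smul_eq_zero.1 h0.symm with h | h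
            · exact h
            · exact absurd h hx
          exact eq_zero_of_pow_eq_zero this
        change (u : End K V) x = 0
        rw [hu, hc0, zero_smul]
      rw [hb, finrank_bot] at h
      omega
    have h7 : (n + 1).choose 2 = n + n.choose 2 := by
      rw [Nat.choose_succ_succ', Nat.choose_one_right]
    omega

/-- Gerstenhaber's theorem for matrices. -/
theorem finrank_le_of_forall_isNilpotent {d : ℕ} (N₀ : Submodule ℂ (Matrix (Fin d) (Fin d) ℂ))
    (h : ∀ N ∈ N₀, IsNilpotent N) : Module.finrank ℂ N₀ ≤ d * (d - 1) / 2 := by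
  rw [← Nat.choose_two_right]
  have := finrank_le_choose_two_of_isNilpotent (K := ℂ) d (V := Fin d → ℂ) (by simp)
    (N₀.map (Matrix.toLinAlgEquiv' (R := ℂ) (n := Fin d)).toLinearMap) (by
      rintro _ ⟨N, hN, rfl⟩
      exact (h N hN).map (Matrix.toLinAlgEquiv' (R := ℂ) (n := Fin d)))
  have e := LinearEquiv.finrank_map_eq (Matrix.toLinAlgEquiv' (R := ℂ) (n := Fin d)).toLinearEquiv N₀
  exact e.symm.le.trans this

end GConc

namespace GConc

/-! ### Determinants and nilpotency. -/

section Nilpotent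

variable {d : ℕ}

theorem det_smul_one_add_of_isNilpotent {N : Matrix (Fin d) (Fin d) ℂ} (hN : IsNilpotent N)
    (c : ℂ) : (c • 1 + N).det = c ^ d := by
  have h := (Matrix.isNilpotent_charpoly_sub_pow_of_isNilpotent hN.neg).eq_zero
  have h2 := Matrix.eval_charpoly (-N) c
  rw [sub_eq_zero.1 h] at h2
  simpa [Matrix.smul_one_eq_diagonal] using h2.symm

/-- Over ℂ the characteristic polynomial is then a power of the variable, and Cayley–Hamilton
applies. -/
theorem isNilpotent_of_det_ne_zero {M : Matrix (Fin d) (Fin d) ℂ}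
    (h : ∀ c : ℂ, c ≠ 0 → (c • 1 - M).det ≠ 0) : IsNilpotent M := by
  have hs := (IsAlgClosed.splits M.charpoly).eq_prod_roots_of_monic M.charpoly_monic
  have hr : M.charpoly.roots = Multiset.replicate M.charpoly.roots.card 0 := by
    refine Multiset.eq_replicate_card.2 fun c hc => ?_
    by_contra hc0
    refine h c hc0 ?_
    have := (Polynomial.mem_roots'.1 hc).2
    rwa [Polynomial.IsRoot, Matrix.eval_charpoly, Matrix.scalar_apply, ← Matrix.smul_one_eq_diagonal] at this
  refine ⟨M.charpoly.roots.card, ?_⟩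
  have := M.aeval_self_charpoly
  rw [hs, hr] at this
  simpa using this

/-- Take for `c` an eigenvalue of `X⁻¹ * M`. -/
theorem exists_det_sub_smul_eq_zero (hd : d ≠ 0) {X : Matrix (Fin d) (Fin d) ℂ} (hX : X.det ≠ 0)
    (M : Matrix (Fin d) (Fin d) ℂ) : ∃ c : ℂ, (M - c • X).det = 0 := by
  have hu : IsUnit X.det := hX.isUnit
  obtain ⟨c, hc⟩ := IsAlgClosed.exists_root (X⁻¹ * M).charpoly (by
    rw [Matrix.charpoly_degree_eq_dim]; simpa using hd)
  refine ⟨c, ?_⟩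
  rw [Polynomial.IsRoot, Matrix.eval_charpoly] at hc
  have : M - c • X = -(X * (Matrix.scalar (Fin d) c - X⁻¹ * M)) := by
    rw [mul_sub, ← mul_assoc, Matrix.mul_nonsing_inv _ hu]
    simp [← Matrix.smul_one_eq_diagonal]
  rw [this, Matrix.det_neg, Matrix.det_mul, hc]
  simp

end Nilpotent

variable {d : ℕ}

/-! ### Unnormalized decompositions and the support. -/

theorem dim_ne_zero {ρ : Op d} (hρ : IsDensityMatrix ρ) : d ≠ 0 := by
  rintro rfl
  simpa [Matrix.trace] using hρ.trace_eq_one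

/-- `pureG` and `proj` scale by the same factor, so weights can be absorbed into the vectors. -/
theorem pureG_smul (hd : d ≠ 0) (c : ℂ) (x : Vec d) : pureG (c • x) = ‖c‖ ^ 2 * pureG x := by
  have : (d : ℝ) ≠ 0 := by exact_mod_cast hd
  rw [pureG, map_smul, Matrix.det_smul, norm_mul, Real.mul_rpow (by positivity) (by positivity),
    pureG, norm_pow, ← Real.rpow_natCast, ← Real.rpow_mul (by positivity)]
  congr 1
  rw [← Real.rpow_natCast]
  congr 1
  simp [mul_div_cancel₀ _ this]

theorem pureG_nonneg (x : Vec d) : 0 ≤ pureG x := by unfold pureG; positivity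

theorem pureG_eq_zero_iff (hd : d ≠ 0) (x : Vec d) : pureG x = 0 ↔ (toMat d x).det = 0 := by
  rw [pureG, Real.rpow_eq_zero (norm_nonneg _) (by positivity), norm_eq_zero]

theorem proj_smul (c : ℂ) (x : Vec d) : proj (c • x) = ((‖c‖ ^ 2 : ℝ) : ℂ) • proj x := by
  ext a b
  simp [proj, Matrix.vecMulVec_apply, ← Complex.mul_conj']
  ring

theorem star_dotProduct_self_re (y : Vec d) :
    (((star y ⬝ᵥ y).re : ℝ) : ℂ) = star y ⬝ᵥ y := by
  have h : 0 ≤ star y ⬝ᵥ y := by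
    exact dotProduct_star_self_nonneg y
  exact Complex.ext rfl (Complex.le_def.1 h).2

theorem trace_proj (y : Vec d) : (proj y).trace = star y ⬝ᵥ y := by
  rw [proj, Matrix.trace_vecMulVec, dotProduct_comm]

/-- A decomposition into unnormalized pure states gives an average. -/
theorem sum_pureG_mem_averages {ρ : Op d} (hρ : IsDensityMatrix ρ) {ι : Type*} [Fintype ι]
    (x : ι → Vec d) (hx : ρ = ∑ i, proj (x i)) : ∑ i, pureG (x i) ∈ averages ρ := by
  have hd := dim_ne_zero hρ
  have hnn : ∀ y : Vec d, 0 ≤ (star y ⬝ᵥ y).re := fun y =>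
    (Complex.le_def.1 (dotProduct_star_self_nonneg y)).1
  have hdec : ∀ y : Vec d, ∃ ψ : Vec d, IsUnitVec ψ ∧
      proj y = (star y ⬝ᵥ y).re • proj ψ ∧ pureG y = (star y ⬝ᵥ y).re * pureG ψ := by
    intro y
    by_cases hy : y = 0
    -- The zero vector gets weight 0, so any unit vector serves.
    · have : NeZero d := ⟨hd⟩
      refine ⟨Pi.single (0, 0) 1, by simp [IsUnitVec], ?_, ?_⟩
      · simp [hy, proj]
      · rw [hy, (pureG_eq_zero_iff hd _).2]
        · simp
        · have : Nonempty (Fin d) := ⟨0⟩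
          rw [map_zero, Matrix.det_zero]
    · have hs : (star y ⬝ᵥ y).re ≠ 0 := fun h => hy (by
        rw [← dotProduct_self_star_eq_zero, dotProduct_comm, ← star_dotProduct_self_re, h]; simp)
      set s := (star y ⬝ᵥ y).re with hsdef
      have hc : ‖((√s : ℝ) : ℂ)‖ ^ 2 = s := by
        rw [Complex.norm_real, Real.norm_eq_abs, sq_abs, Real.sq_sqrt (hnn y)]
      have hr : ((√s : ℝ) : ℂ) ≠ 0 := by
        intro h; rw [h] at hc; simp at hc; exact hs hc.symm
      obtain ⟨ψ, hyψ⟩ : ∃ ψ, y = ((√s : ℝ) : ℂ) • ψ := ⟨(((√s : ℝ) : ℂ))⁻¹ • y, by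
        rw [smul_smul, mul_inv_cancel₀ hr, one_smul]⟩
      refine ⟨ψ, ?_, ?_, ?_⟩
      · have h := star_dotProduct_self_re y
        rw [← hsdef, hyψ, star_smul, smul_dotProduct, dotProduct_smul, smul_smul, smul_eq_mul,
          Complex.star_def, Complex.conj_mul', ← Complex.ofReal_pow, hc] at h
        exact mul_left_cancel₀ (Complex.ofReal_ne_zero.2 hs) (by rw [← h, mul_one])
      · rw [hyψ, proj_smul, hc, Complex.coe_smul]
      · rw [hyψ, pureG_smul hd, hc]
  choose ψ hψ hp hg using hdec
  let f := (Fintype.equivFin ι).symm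
  refine ⟨Fintype.card ι, fun j => (star (x (f j)) ⬝ᵥ x (f j)).re, fun j => ψ (x (f j)),
    ⟨fun j => hnn _, ?_, fun j => hψ _, ?_⟩, ?_⟩
  · rw [f.sum_comp fun i => (star (x i) ⬝ᵥ x i).re, ← Complex.re_sum]
    have := hρ.trace_eq_one
    rw [hx, Matrix.trace_sum] at this
    simp_rw [trace_proj] at this
    rw [this, Complex.one_re]
  · simp_rw [← hp]
    rw [hx]
    exact (f.sum_comp fun i => proj (x i)).symm
  · simp_rw [← hg]
    exact (f.sum_comp fun i => pureG (x i)).symm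

/-- Every average comes from a decomposition into unnormalized pure states. -/
theorem exists_of_mem_averages (hd : d ≠ 0) {ρ : Op d} {t : ℝ} (ht : t ∈ averages ρ) :
    ∃ (n : ℕ) (x : Fin n → Vec d), ρ = ∑ i, proj (x i) ∧ t = ∑ i, pureG (x i) := by
  obtain ⟨n, p, ψ, h, rfl⟩ := ht
  have hc : ∀ j, ‖((√(p j) : ℝ) : ℂ)‖ ^ 2 = p j := fun j => by
    rw [Complex.norm_real, Real.norm_eq_abs, sq_abs, Real.sq_sqrt (h.nonneg j)]
  refine ⟨n, fun j => ((√(p j) : ℝ) : ℂ) • ψ j, ?_, ?_⟩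
  · simp_rw [proj_smul, hc, Complex.coe_smul]
    exact h.eq_sum
  · simp_rw [pureG_smul hd, hc]

theorem sum_proj_eq_mul_conjTranspose {ι : Type*} [Fintype ι] (x : ι → Vec d) :
    ∑ i, proj (x i) = (Matrix.of x)ᵀ * ((Matrix.of x)ᵀ)ᴴ := by
  ext a b
  simp [Matrix.sum_apply, Matrix.mul_apply, proj, Matrix.vecMulVec_apply]

open scoped MatrixOrder in
theorem exists_eq_conjTranspose_mul_self {τ : Op d} (hτ : τ.PosSemidef) :
    ∃ B : Op d, τ = Bᴴ * B :=
  CStarAlgebra.nonneg_iff_eq_star_mul_self.mp hτ.nonneg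

theorem exists_eq_sum_proj {τ : Op d} (hτ : τ.PosSemidef) :
    ∃ y : Fin d × Fin d → Vec d, τ = ∑ k, proj (y k) := by
  obtain ⟨B, rfl⟩ := exists_eq_conjTranspose_mul_self hτ
  refine ⟨fun k => (Bᴴ)ᵀ k, ?_⟩
  rw [sum_proj_eq_mul_conjTranspose]
  change _ = Bᴴᵀᵀ * (Bᴴᵀᵀ)ᴴ
  simp

/-- A small multiple of the projection on a vector of the support can be subtracted. -/
theorem exists_posSemidef_sub {ρ : Op d} (hρ : ρ.PosSemidef) {a : Vec d} (ha : a ∈ supp ρ) :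
    ∃ ε : ℝ, 0 < ε ∧ (ρ - ε • proj a).PosSemidef := by
  obtain ⟨B, rfl⟩ := exists_eq_conjTranspose_mul_self hρ
  obtain ⟨w, rfl⟩ := ha
  set u := B *ᵥ w with hu
  set m := (star u ⬝ᵥ u).re with hm
  have hm0 : 0 ≤ m :=
    (Complex.le_def.1 (dotProduct_star_self_nonneg u)).1
  have hP : proj u * proj u = m • proj u := by
    rw [proj, Matrix.vecMulVec_mul_vecMulVec, ← star_dotProduct_self_re, ← Complex.coe_smul,
      Matrix.vecMulVec_smul]
  have hPh : (proj u)ᴴ = proj u := by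
    simp [proj, Matrix.conjTranspose_vecMulVec]
  -- With P = `proj u`, P² = mP and sm = 1 - s, so (1 - sP)² = 1 - (2s - s²m)P = 1 - (s + s²)P.
  -- Conjugating by `B` gives the claim.
  set s := (1 + m)⁻¹ with hs
  have hs0 : 0 < s := by positivity
  have hsm : s * m = 1 - s := by rw [hs]; field_simp; ring
  refine ⟨s + s ^ 2, by positivity, ?_⟩
  have e : (Bᴴ * B).mulVecLin w = Bᴴ *ᵥ u := by simp [hu]
  have e2 : proj (Bᴴ *ᵥ u) = Bᴴ * proj u * B := by
    rw [proj, proj, Matrix.mul_vecMulVec, Matrix.vecMulVec_mul, Matrix.star_mulVec,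
      Matrix.conjTranspose_conjTranspose]
  have e3 : (1 - s • proj u)ᴴ * (1 - s • proj u) = 1 - (s + s ^ 2) • proj u := by
    rw [Matrix.conjTranspose_sub, Matrix.conjTranspose_smul, hPh, Matrix.conjTranspose_one,
      star_trivial, sub_mul, mul_sub, one_mul, mul_sub, mul_one, smul_mul_smul_comm, hP, smul_smul,
      mul_assoc, hsm]
    rw [one_mul]
    module
  have e4 : Bᴴ * B - (s + s ^ 2) • proj ((Bᴴ * B).mulVecLin w) =
      ((1 - s • proj u) * B)ᴴ * ((1 - s • proj u) * B) := by
    rw [e, e2, Matrix.conjTranspose_mul, mul_assoc Bᴴ _ (_ * B),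
      ← mul_assoc (1 - s • proj u)ᴴ, e3]
    simp [mul_sub, sub_mul, mul_assoc]
  rw [e4]
  exact Matrix.posSemidef_conjTranspose_mul_self _

/-- Every vector in a decomposition lies in the support. -/
theorem mem_supp_of_eq_sum {ρ : Op d} {ι : Type*} [Fintype ι]
    (x : ι → Vec d) (hx : ρ = ∑ i, proj (x i)) (i : ι) : x i ∈ supp ρ := by
  classical
  rw [sum_proj_eq_mul_conjTranspose] at hx
  set A := (Matrix.of x)ᵀ with hA
  have hle : supp ρ ≤ LinearMap.range A.mulVecLin := by
    rintro _ ⟨v, rfl⟩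
    exact ⟨Aᴴ *ᵥ v, by simp [hx]⟩
  -- A Aᴴ and A have the same rank, so the inclusion of ranges is an equality.
  have h : supp ρ = LinearMap.range A.mulVecLin := by
    refine Submodule.eq_of_le_of_finrank_eq hle ?_
    change ρ.rank = A.rank
    rw [hx, Matrix.rank_self_mul_conjTranspose]
  rw [h]
  refine ⟨Pi.single i 1, ?_⟩
  ext a
  simp [hA]

end GConc

namespace GConc

variable {d : ℕ}

/-! ### Equal averages force the nilpotent structure. -/

theorem proj_add_add_proj_sub (a b : Vec d) :
    proj (a + b) + proj (a - b) = (2 : ℝ) • proj a + (2 : ℝ) • proj b := by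
  ext i j
  simp [proj, Matrix.vecMulVec_apply]
  ring

theorem finrank_matSupp (ρ : Op d) : Module.finrank ℂ (matSupp ρ) = ρ.rank :=
  LinearEquiv.finrank_map_eq (toMat d) (supp ρ)

theorem toMat_mem_matSupp {ρ : Op d} {x : Vec d} : toMat d x ∈ matSupp ρ ↔ x ∈ supp ρ := by
  refine ⟨?_, fun h => ⟨x, h, rfl⟩⟩
  rintro ⟨y, hy, e⟩
  rwa [← (toMat d).injective e]

/-- If all pure state decompositions have the same average, then the singular vectors of the
support are closed under addition. -/
theorem pureG_add_eq_zero {ρ : Op d} (hρ : IsDensityMatrix ρ)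
    (h : ∀ s ∈ averages ρ, ∀ t ∈ averages ρ, s = t) {a b : Vec d} (ha : a ∈ supp ρ)
    (hb : b ∈ supp ρ) (ha0 : pureG a = 0) (hb0 : pureG b = 0) : pureG (a + b) = 0 := by
  have hd := dim_ne_zero hρ
  obtain ⟨ε₁, hε₁, h₁⟩ := exists_posSemidef_sub hρ.posSemidef ha
  obtain ⟨ε₂, hε₂, h₂⟩ := exists_posSemidef_sub hρ.posSemidef hb
  -- Twice `r ^ 2` is subtracted for each vector, each from its own half of `ρ`; hence the factor 4.
  obtain ⟨r, hr, hr1, hr2⟩ : ∃ r : ℝ, 0 < r ∧ 4 * r ^ 2 ≤ ε₁ ∧ 4 * r ^ 2 ≤ ε₂ := by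
    refine ⟨√(min ε₁ ε₂ / 4), by positivity, ?_, ?_⟩ <;> rw [Real.sq_sqrt (by positivity)]
    · linarith [min_le_left ε₁ ε₂]
    · linarith [min_le_right ε₁ ε₂]
  have hps : ∀ x : Vec d, (proj x).PosSemidef := Matrix.posSemidef_vecMulVec_self_star
  have hτ : (ρ - (2 * r ^ 2) • proj a - (2 * r ^ 2) • proj b).PosSemidef := by
    have e : ρ - (2 * r ^ 2) • proj a - (2 * r ^ 2) • proj b =
        (1 / 2 : ℝ) • (ρ - ε₁ • proj a) + (1 / 2 : ℝ) • (ρ - ε₂ • proj b) +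
          ((ε₁ / 2 - 2 * r ^ 2) • proj a + (ε₂ / 2 - 2 * r ^ 2) • proj b) := by
      module
    rw [e]
    refine ((h₁.smul (by norm_num)).add (h₂.smul (by norm_num))).add
      (((hps a).smul ?_).add ((hps b).smul ?_)) <;> linarith
  obtain ⟨y, hy⟩ := exists_eq_sum_proj hτ
  have hrn : ‖(r : ℂ)‖ ^ 2 = r ^ 2 := by simp
  -- Both decompositions share the remainder `y`; `a` and `b` contribute nothing, so the terms of `a
  -- + b` and `a - b` must vanish.
  have m1 := sum_pureG_mem_averages hρ
    (Sum.elim y ![(r : ℂ) • a, (r : ℂ) • a, (r : ℂ) • b, (r : ℂ) • b]) (by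
      simp only [Fintype.sum_sum_type, Sum.elim_inl, Sum.elim_inr, ← hy, Fin.sum_univ_four]
      simp only [Matrix.cons_val, proj_smul, hrn]
      simp only [Complex.coe_smul]
      module)
  have m2 := sum_pureG_mem_averages hρ
    (Sum.elim y ![(r : ℂ) • (a + b), (r : ℂ) • (a - b)]) (by
      simp only [Fintype.sum_sum_type, Sum.elim_inl, Sum.elim_inr, ← hy, Fin.sum_univ_two]
      simp only [Matrix.cons_val, proj_smul, hrn]
      simp only [Complex.coe_smul]
      rw [← smul_add, proj_add_add_proj_sub]
      module)
  have := h _ m1 _ m2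
  simp only [Fintype.sum_sum_type, Sum.elim_inl, Sum.elim_inr, Fin.sum_univ_four,
    Fin.sum_univ_two, Matrix.cons_val, pureG_smul hd, hrn, ha0, hb0] at this
  have hp := pureG_nonneg (a + b)
  have hm := pureG_nonneg (a - b)
  have hr2 : 0 < r ^ 2 := by positivity
  nlinarith [mul_nonneg hr2.le hp, mul_nonneg hr2.le hm]

/-- If the singular matrices of a space with an invertible element `X` form a subspace, then the
space consists of the matrices `X * (c • 1 + N)` with `N` in a space of nilpotent matrices. -/
theorem exists_nilpotent_of_det_add (hd : d ≠ 0)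
    (S : Submodule ℂ (Matrix (Fin d) (Fin d) ℂ))
    (hS : ∀ A ∈ S, ∀ B ∈ S, A.det = 0 → B.det = 0 → (A + B).det = 0)
    {X : Matrix (Fin d) (Fin d) ℂ} (hXS : X ∈ S) (hX : X.det ≠ 0) :
    ∃ N₀ : Submodule ℂ (Matrix (Fin d) (Fin d) ℂ), (∀ N ∈ N₀, IsNilpotent N) ∧
      Module.finrank ℂ N₀ + 1 = Module.finrank ℂ S ∧
      (S : Set (Matrix (Fin d) (Fin d) ℂ)) =
        {M | ∃ (c : ℂ) (N : Matrix (Fin d) (Fin d) ℂ), N ∈ N₀ ∧ M = X * (c • 1 + N)} := by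
  have hu : IsUnit X.det := hX.isUnit
  have hne : Nonempty (Fin d) := Fin.pos_iff_nonempty.1 (Nat.pos_of_ne_zero hd)
  let Z : Submodule ℂ (Matrix (Fin d) (Fin d) ℂ) :=
    { carrier := {M | M ∈ S ∧ M.det = 0}
      zero_mem' := ⟨S.zero_mem, Matrix.det_zero⟩
      add_mem' := fun {A B} hA hB => ⟨S.add_mem hA.1 hB.1, hS A hA.1 B hB.1 hA.2 hB.2⟩
      smul_mem' := fun c A hA => ⟨S.smul_mem c hA.1, by rw [Matrix.det_smul, hA.2, mul_zero]⟩ }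
  have hZ : ∀ M, M ∈ Z ↔ M ∈ S ∧ M.det = 0 := fun _ => Iff.rfl
  have hcX : ∀ c : ℂ, c • X ∈ Z → c = 0 := fun c hc => by
    have := ((hZ _).1 hc).2
    rw [Matrix.det_smul, mul_eq_zero, or_iff_left hX] at this
    exact eq_zero_of_pow_eq_zero this
  let e : Matrix (Fin d) (Fin d) ℂ →ₗ[ℂ] Matrix (Fin d) (Fin d) ℂ := LinearMap.mulLeft ℂ X⁻¹
  have he : Function.Injective e := fun A B h => by
    have := congrArg (X * ·) h
    simpa [e, ← mul_assoc, Matrix.mul_nonsing_inv _ hu] using this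
  refine ⟨Z.map e, ?_, ?_, ?_⟩
  · rintro _ ⟨N, hN, rfl⟩
    -- A nonzero eigenvalue `c` puts `c • X - N`, hence `c • X`, in `Z`.
    refine isNilpotent_of_det_ne_zero fun c hc h => hc (hcX c ?_)
    have h2 : c • X - N ∈ Z := by
      refine ⟨S.sub_mem (S.smul_mem c hXS) hN.1, ?_⟩
      have : c • X - N = X * (c • 1 - e N) := by
        simp [e, mul_sub, ← mul_assoc, Matrix.mul_nonsing_inv _ hu]
      rw [this, Matrix.det_mul, h, mul_zero]
    simpa using Z.add_mem h2 hN
  · rw [← (Submodule.equivMapOfInjective e he Z).finrank_eq]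
    have h1 : Z ⊔ ℂ ∙ X = S := by
      refine le_antisymm (sup_le (fun M hM => hM.1) ?_) fun M hM => ?_
      · rwa [Submodule.span_singleton_le_iff_mem]
      · obtain ⟨c, hc⟩ := exists_det_sub_smul_eq_zero hd hX M
        exact Submodule.mem_sup.2 ⟨M - c • X, ⟨S.sub_mem hM (S.smul_mem c hXS), hc⟩, c • X,
          Submodule.smul_mem _ _ (Submodule.mem_span_singleton_self X), by simp⟩
    have h2 : Z ⊓ ℂ ∙ X = ⊥ := by
      rw [eq_bot_iff]
      rintro _ ⟨hM, hM'⟩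
      obtain ⟨c, rfl⟩ := Submodule.mem_span_singleton.1 hM'
      simp [hcX c hM]
    have h := Submodule.finrank_sup_add_finrank_inf_eq Z (ℂ ∙ X)
    rw [h1, h2, finrank_bot, finrank_span_singleton (by rintro rfl; simp at hX)] at h
    omega
  · ext M
    constructor
    · intro hM
      obtain ⟨c, hc⟩ := exists_det_sub_smul_eq_zero hd hX M
      refine ⟨c, e (M - c • X), ⟨_, ⟨S.sub_mem hM (S.smul_mem c hXS), hc⟩, rfl⟩, ?_⟩
      simp [e, mul_add, ← mul_assoc, Matrix.mul_nonsing_inv _ hu]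
    · rintro ⟨c, _, ⟨N, hN, rfl⟩, rfl⟩
      have : X * (c • 1 + e N) = c • X + N := by
        simp [e, mul_add, ← mul_assoc, Matrix.mul_nonsing_inv _ hu]
      rw [this]
      exact S.add_mem (S.smul_mem c hXS) hN.1

/-! ### The nilpotent structure forces equal averages. -/

/-- The sum of `‖w ⬝ᵥ x‖ ^ 2` over a decomposition of `ρ` depends on `ρ` only. -/
theorem sum_norm_sq_eq {ι : Type*} [Fintype ι] (w : Vec d) (x : ι → Vec d) :
    ∑ i, ‖w ⬝ᵥ x i‖ ^ 2 = (w ⬝ᵥ (∑ i, proj (x i)) *ᵥ star w).re := by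
  rw [Matrix.sum_mulVec, dotProduct_sum, Complex.re_sum]
  refine Finset.sum_congr rfl fun i _ => ?_
  have h : w ⬝ᵥ proj (x i) *ᵥ star w = ((‖w ⬝ᵥ x i‖ ^ 2 : ℝ) : ℂ) := by
    rw [proj, Matrix.vecMulVec_mulVec, dotProduct_smul, Matrix.star_dotProduct_star,
      Complex.ofReal_pow, ← Complex.mul_conj']
    simp
  rw [h, Complex.ofReal_re]

/-- The linear functional `tr (X⁻¹ M) / d`, as a vector. -/
theorem exists_functional (Y : Matrix (Fin d) (Fin d) ℂ) :
    ∃ w : Vec d, ∀ x, w ⬝ᵥ x = (Y * toMat d x).trace / d := by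
  refine ⟨fun p => Y p.2 p.1 / d, fun x => ?_⟩
  rw [Matrix.trace, dotProduct, Fintype.sum_prod_type_right, Finset.sum_div]
  refine Finset.sum_congr rfl fun i _ => ?_
  rw [Matrix.diag_apply, Matrix.mul_apply, Finset.sum_div]
  refine Finset.sum_congr rfl fun j _ => ?_
  change Y i j / d * x (j, i) = Y i j * x (j, i) / d
  ring

/-- Nilpotents have trace zero, so the normalized trace recovers `c`, while the determinant sees
only `c ^ d`. -/
theorem pureG_eq_of_mem (hd : d ≠ 0) {X N : Matrix (Fin d) (Fin d) ℂ} (hX : IsUnit X)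
    (hN : IsNilpotent N) (c : ℂ) {x : Vec d} (hx : toMat d x = X * (c • 1 + N)) :
    pureG x = ‖X.det‖ ^ ((2 : ℝ) / d) * ‖(X⁻¹ * toMat d x).trace / d‖ ^ 2 := by
  have hu : IsUnit X.det := (Matrix.isUnit_iff_isUnit_det X).1 hX
  have hd' : (d : ℂ) ≠ 0 := by exact_mod_cast hd
  have hd'' : (d : ℝ) ≠ 0 := by exact_mod_cast hd
  have e : (X⁻¹ * toMat d x).trace / d = c := by
    rw [hx, ← mul_assoc, Matrix.nonsing_inv_mul _ hu, one_mul, Matrix.trace_add,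
      (Matrix.isNilpotent_trace_of_isNilpotent hN).eq_zero, Matrix.trace_smul, Matrix.trace_one]
    simp [mul_div_cancel_right₀ _ hd']
  rw [e, pureG, hx, Matrix.det_mul, det_smul_one_add_of_isNilpotent hN, norm_mul,
    Real.mul_rpow (by positivity) (by positivity), norm_pow, ← Real.rpow_natCast,
    ← Real.rpow_mul (by positivity), mul_div_cancel₀ _ hd'']
  norm_cast

theorem G_eq_Ga_and_pos_of_support {ρ : Op d} (hρ : IsDensityMatrix ρ)
    {X : Matrix (Fin d) (Fin d) ℂ} {N₀ : Submodule ℂ (Matrix (Fin d) (Fin d) ℂ)} (hX : IsUnit X)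
    (hN : ∀ N ∈ N₀, IsNilpotent N)
    (hS : (matSupp ρ : Set (Matrix (Fin d) (Fin d) ℂ)) =
      {M | ∃ (c : ℂ) (N : Matrix (Fin d) (Fin d) ℂ), N ∈ N₀ ∧ M = X * (c • 1 + N)}) :
    G ρ = Ga ρ ∧ 0 < G ρ := by
  have hd := dim_ne_zero hρ
  have hd' : (d : ℂ) ≠ 0 := by exact_mod_cast hd
  have hu : IsUnit X.det := (Matrix.isUnit_iff_isUnit_det X).1 hX
  obtain ⟨w, hw⟩ := exists_functional X⁻¹
  set κ := ‖X.det‖ ^ ((2 : ℝ) / d) with hκ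
  have hκ0 : 0 < κ := Real.rpow_pos_of_pos (norm_pos_iff.2 hu.ne_zero) _
  have hG : ∀ x ∈ supp ρ, pureG x = κ * ‖w ⬝ᵥ x‖ ^ 2 := by
    intro x hx
    have : toMat d x ∈ (matSupp ρ : Set (Matrix (Fin d) (Fin d) ℂ)) := toMat_mem_matSupp.2 hx
    rw [hS] at this
    obtain ⟨c, N, hN₀, e⟩ := this
    rw [hw, pureG_eq_of_mem hd hX (hN N hN₀) c e]
  have hav : ∀ t ∈ averages ρ, t = κ * (w ⬝ᵥ ρ *ᵥ star w).re := by
    intro t ht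
    obtain ⟨n, x, hx, rfl⟩ := exists_of_mem_averages hd ht
    conv_rhs => rw [hx]
    rw [← sum_norm_sq_eq, Finset.mul_sum]
    exact Finset.sum_congr rfl fun i _ => hG _ (mem_supp_of_eq_sum x hx i)
  have hGm := (isLeast_G hρ).1
  refine ⟨(hav _ hGm).trans (hav _ (isGreatest_Ga hρ).1).symm, ?_⟩
  -- A zero average would make `w` vanish on the whole range of `ρ`, but `w` takes the value 1 at
  -- `X`.
  obtain ⟨n, x, hx, e⟩ := exists_of_mem_averages hd hGm
  rw [e]
  refine (Finset.sum_nonneg fun i _ => pureG_nonneg _).lt_of_ne' fun h0 => ?_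
  have hw0 : ∀ i, w ⬝ᵥ x i = 0 := fun i => by
    have := (Finset.sum_eq_zero_iff_of_nonneg fun i _ => pureG_nonneg (x i)).1 h0 i
      (Finset.mem_univ i)
    rw [hG _ (mem_supp_of_eq_sum x hx i)] at this
    simpa [hκ0.ne'] using this
  obtain ⟨v, hv⟩ : (toMat d).symm X ∈ supp ρ := by
    rw [← toMat_mem_matSupp, LinearEquiv.apply_symm_apply, ← SetLike.mem_coe, hS]
    exact ⟨1, 0, N₀.zero_mem, by simp⟩
  have h1 : w ⬝ᵥ (toMat d).symm X = 1 := by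
    rw [hw, LinearEquiv.apply_symm_apply, Matrix.nonsing_inv_mul _ hu, Matrix.trace_one,
      Fintype.card_fin, div_self hd']
  rw [← hv, Matrix.mulVecLin_apply, hx, Matrix.sum_mulVec, dotProduct_sum,
    Finset.sum_eq_zero fun i _ => ?_] at h1
  · exact zero_ne_one h1
  · rw [proj, Matrix.vecMulVec_mulVec, dotProduct_smul, hw0, smul_zero]

theorem exists_support_of_G_eq_Ga {ρ : Op d} (hρ : IsDensityMatrix ρ) (h : G ρ = Ga ρ)
    (hpos : 0 < G ρ) :
    ∃ (X : Matrix (Fin d) (Fin d) ℂ) (N₀ : Submodule ℂ (Matrix (Fin d) (Fin d) ℂ)),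
      IsUnit X ∧ (∀ N ∈ N₀, IsNilpotent N) ∧ Module.finrank ℂ N₀ + 1 = ρ.rank ∧
      (matSupp ρ : Set (Matrix (Fin d) (Fin d) ℂ)) =
        {M | ∃ (c : ℂ) (N : Matrix (Fin d) (Fin d) ℂ), N ∈ N₀ ∧ M = X * (c • 1 + N)} := by
  have hd := dim_ne_zero hρ
  have hc : ∀ t ∈ averages ρ, t = G ρ := fun t ht =>
    le_antisymm (h ▸ (isGreatest_Ga hρ).2 ht) ((isLeast_G hρ).2 ht)
  obtain ⟨n, x, hx, e⟩ := exists_of_mem_averages hd (isLeast_G hρ).1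
  -- A positive average has a nonzero term; its vector is the invertible `X`.
  obtain ⟨i, -, hi⟩ := Finset.exists_ne_zero_of_sum_ne_zero (e ▸ hpos.ne')
  have hX : (toMat d (x i)).det ≠ 0 := fun h => hi ((pureG_eq_zero_iff hd _).2 h)
  obtain ⟨N₀, h1, h2, h3⟩ := exists_nilpotent_of_det_add hd (matSupp ρ) (by
    rintro _ ⟨a, ha, rfl⟩ _ ⟨b, hb, rfl⟩ ha0 hb0
    refine (pureG_eq_zero_iff hd (a + b)).1 (pureG_add_eq_zero hρ
      (fun s hs t ht => (hc s hs).trans (hc t ht).symm) ha hb ?_ ?_)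
    · exact (pureG_eq_zero_iff hd a).2 ha0
    · exact (pureG_eq_zero_iff hd b).2 hb0)
    (toMat_mem_matSupp.2 (mem_supp_of_eq_sum x hx i)) hX
  exact ⟨_, N₀, (Matrix.isUnit_iff_isUnit_det _).2 hX.isUnit, h1, h2.trans (finrank_matSupp ρ), h3⟩

end GConc

theorem theorem7 (d : ℕ) (ρ : GConc.Op d) (hρ : GConc.IsDensityMatrix ρ) :
    (GConc.G ρ = GConc.Ga ρ ∧ 0 < GConc.G ρ) ↔
      (ρ.rank ≤ 1 + d * (d - 1) / 2 ∧
        ∃ (X : Matrix (Fin d) (Fin d) ℂ) (N₀ : Submodule ℂ (Matrix (Fin d) (Fin d) ℂ)),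
          IsUnit X ∧ (∀ N ∈ N₀, IsNilpotent N) ∧ Module.finrank ℂ N₀ + 1 = ρ.rank ∧
          (GConc.matSupp ρ : Set (Matrix (Fin d) (Fin d) ℂ)) =
            {M | ∃ (c : ℂ) (N : Matrix (Fin d) (Fin d) ℂ), N ∈ N₀ ∧ M = X * (c • 1 + N)}) := by
  constructor
  · rintro ⟨h, hpos⟩
    obtain ⟨X, N₀, hX, hN, hr, hS⟩ := GConc.exists_support_of_G_eq_Ga hρ h hpos
    refine ⟨?_, X, N₀, hX, hN, hr, hS⟩
    have := GConc.finrank_le_of_forall_isNilpotent N₀ hN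
    omega
  · rintro ⟨-, X, N₀, hX, hN, -, hS⟩
    exact GConc.G_eq_Ga_and_pos_of_support hρ hX hN hS
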